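/- All graphs are simple, finite and unweighted unless a weight is mentioned. In a connected graph with positive edge weights (conductances), the resistance distance $R(u,v)$ is the potential difference between $u$ and $v$ when a unit current enters at $u$ and leaves at $v$; all edge weights are $1$ in an unweighted graph. The Kirchhoff index $Kf$ is the sum of $R(u,v)$ over all unordered pairs $\{u,v\}$ of distinct vertices. Let $k\ge 2$ and $t\ge 1$ be integers, let $H$ be a connected graph with vertex set $\{v_1,\dots,v_k\}$, and let $p_i,q_i\ge 0$ $(1\le i\le k)$ be integers such that $n_i:=tp_i+q_i\ge 1$ for all $i$. Let $G=H_{p_1,\dots,p_k}^{q_1,\dots,q_k}$ be the graph obtained from $H$ by replacing each $v_i$ by the graph $G_i=p_iK_t\cup q_iK_1$ and joining every vertex of $G_i$ to every vertex of $G_j$ whenever $v_iv_j\in E(H)$. Write $V_i^{p_i}$ for the set of vertices of the $p_i$ copies of $K_t$ in $G_i$ and $V_i^{q_i}$ for the set of vertices of the $q_i$ copies of $K_1$ in $G_i$. Let $H^{\bigtriangledown}$ be the graph $H$ in which each edge $v_av_b$ has weight $n_an_b$. For $1\le i,j\le k$ put $$r=\frac{1}{\sum_{v_a\in N_H(v_i)}n_a},\quad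 r'=\frac{1}{\sum_{v_b\in N_H(v_j)}n_b},\quad r''=\frac{-1}{n_i\sum_{v_a\in N_H(v_i)}n_a},\quad r'''=\frac{-1}{n_j\sum_{v_b\in N_H(v_j)}n_b}.$$ (i) If $1\le i\le k$ and $u\ne v$, then $$R_G(u,v)=\begin{cases} r_1^{(i)}:=2r, & u,v\in V_i^{q_i};\\ r_2^{(i)}:=\frac{r(r+1)}{tr+1}+r, & u\in V_i^{p_i},\ v\in V_i^{q_i};\\ r_3^{(i)}:=\frac{2r}{tr+1}, & u,v\in V_i^{p_i},\ uv\in E(G);\\ r_4^{(i)}:=\frac{2r(r+1)}{tr+1}, & u,v\in V_i^{p_i},\ uv\notin E(G).\end{cases}$$ (ii) If $1\le i\ne j\le k$, then $$R_G(u,v)=\begin{cases} r_5^{(i,j)}:=R_{H^{\bigtriangledown}}(v_i,v_j)+r+r'+r''+r''', & u\in V_i^{q_i},\ v\in V_j^{q_j};\\ r_6^{(i,j)}:=R_{H^{\bigtriangledown}}(v_i,v_j)+r+\frac{r'(r'+1)}{tr'+1}+r''+r''', & u\in V_i^{q_i},\ v\in V_j^{p_j};\\ r_7^{(i,j)}:=R_{H^{\bigtriangledown}}(v_i,v_j)+\frac{r(r+1)}{tr+1}+r'+r''+r''',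 & u\in V_i^{p_i},\ v\in V_j^{q_j};\\ r_8^{(i,j)}:=R_{H^{\bigtriangledown}}(v_i,v_j)+\frac{r(r+1)}{tr+1}+\frac{r'(r'+1)}{tr'+1}+r''+r''', & u\in V_i^{p_i},\ v\in V_j^{p_j}.\end{cases}$$ (iii) Furthermore, $$Kf(G)=\sum_{i=1}^{k}\left[\binom{q_i}{2}r_1^{(i)}+p_iq_it\,r_2^{(i)}+\binom{t}{2}p_i\,r_3^{(i)}+\binom{p_i}{2}t^2r_4^{(i)}\right]+\sum_{i=1}^{k-1}\left\{q_i\sum_{j=i+1}^{k}\left(q_jr_5^{(i,j)}+p_jt\,r_6^{(i,j)}\right)+p_i\sum_{j=i+1}^{k}\left(q_jt\,r_7^{(i,j)}+p_jt^2r_8^{(i,j)}\right)\right\}.$$ -/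

import Mathlib

open scoped Matrix

noncomputable section

/-! ### Electrical networks and resistance distance -/

open Classical in
/-- The conductance matrix of the edge-weighted graph `(G, w)`: the conductance between `x` and `y`
is the weight `w x y` if `xy` is an edge and `0` otherwise. -/
def conductance {V : Type*} (G : SimpleGraph V) (w : V → V → ℝ) : Matrix V V ℝ :=
  Matrix.of fun x y => if G.Adj x y then w x y else 0

open Classical in
/-- The weighted Laplacian matrix of the edge-weighted graph `(G, w)`. -/
def weightedLaplacian {V : Type*} [Fintype V] (G : SimpleGraph V) (w : V → V → ℝ) :
    Matrix V V ℝ :=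
  Matrix.diagonal (fun x => ∑ y, conductance G w x y) - conductance G w

open Classical in
/-- `φ` is a potential on the vertices of the network `(G, w)` when a unit current enters at `u`
and leaves at `v` (Kirchhoff's current law, the current from `x` to `y` along the edge `xy`
being `w x y * (φ x - φ y)` by Ohm's law). -/
def IsUnitPotential {V : Type*} [Fintype V] (G : SimpleGraph V) (w : V → V → ℝ) (u v : V)
    (φ : V → ℝ) : Prop :=
  weightedLaplacian G w *ᵥ φ = Pi.single u 1 - Pi.single v 1

open Classical in
/-- The resistance distance between `u` and `v` in the network `(G, w)`: the potential difference
between `u` and `v` when a unit current enters at `u` and leaves at `v`. See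
`exists_isUnitPotential` and `resistanceDistW_eq` for existence and independence of choices. -/
def resistanceDistW {V : Type*} [Fintype V] (G : SimpleGraph V) (w : V → V → ℝ) (u v : V) : ℝ :=
  if h : ∃ φ, IsUnitPotential G w u v φ then h.choose u - h.choose v else 0

/-- The resistance distance in a graph all of whose edges have weight `1`. -/
def resistanceDist {V : Type*} [Fintype V] (G : SimpleGraph V) (u v : V) : ℝ :=
  resistanceDistW G (fun _ _ => 1) u v

/-- The Kirchhoff index: the sum of the resistance distances over all unordered pairs of
vertices. -/
def kirchhoffIndex {V : Type*} [Fintype V] (G : SimpleGraph V) : ℝ :=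
  (∑ u, ∑ v, resistanceDist G u v) / 2

/-- The resistance distance in the vertex-weighted graph `(H, m)`, in which the edge `xy` has
weight `m x * m y`. -/
def vertexResistanceDist {V : Type*} [Fintype V] (H : SimpleGraph V) (m : V → ℝ) (u v : V) : ℝ :=
  resistanceDistW H (fun x y => m x * m y) u v

theorem conductance_comm {V : Type*} (G : SimpleGraph V) (w : V → V → ℝ)
    (hw : ∀ x y, w x y = w y x) (x y : V) : conductance G w x y = conductance G w y x := by
  by_cases h : G.Adj x y
  · simp [conductance, h, h.symm, hw x y]
  · have h' : ¬ G.Adj y x := fun h' => h h'.symm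
    simp [conductance, h, h']

theorem weightedLaplacian_mulVec {V : Type*} [Fintype V] (G : SimpleGraph V) (w : V → V → ℝ)
    (φ : V → ℝ) (x : V) :
    (weightedLaplacian G w *ᵥ φ) x = ∑ y, conductance G w x y * (φ x - φ y) := by
  classical
  simp only [weightedLaplacian, Matrix.sub_mulVec, Pi.sub_apply, Matrix.mulVec_diagonal,
    Finset.sum_mul, mul_sub, Finset.sum_sub_distrib]
  rfl

theorem weightedLaplacian_transpose {V : Type*} [Fintype V] (G : SimpleGraph V)
    (w : V → V → ℝ) (hw : ∀ x y, w x y = w y x) :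
    (weightedLaplacian G w)ᵀ = weightedLaplacian G w := by
  classical
  rw [weightedLaplacian, Matrix.transpose_sub, Matrix.diagonal_transpose]
  congr 1
  ext x y
  exact conductance_comm G w hw y x

/-- The potential difference does not depend on the choice of the potential. -/
theorem resistanceDistW_eq {V : Type*} [Fintype V] (G : SimpleGraph V) (w : V → V → ℝ)
    (hw : ∀ x y, w x y = w y x) {u v : V} {φ : V → ℝ} (hφ : IsUnitPotential G w u v φ) :
    resistanceDistW G w u v = φ u - φ v := by
  classical
  have h : ∃ φ, IsUnitPotential G w u v φ := ⟨φ, hφ⟩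
  rw [resistanceDistW, dif_pos h]
  have hψ := h.choose_spec
  set ψ := h.choose
  have key : ψ ⬝ᵥ (weightedLaplacian G w *ᵥ φ) = φ ⬝ᵥ (weightedLaplacian G w *ᵥ ψ) := by
    rw [Matrix.dotProduct_mulVec, ← Matrix.mulVec_transpose, weightedLaplacian_transpose G w hw,
      dotProduct_comm]
  unfold IsUnitPotential at hφ hψ
  rw [hφ, hψ] at key
  simpa [dotProduct_sub] using key

theorem sum_weightedLaplacian_mulVec {V : Type*} [Fintype V] (G : SimpleGraph V)
    (w : V → V → ℝ) (hw : ∀ x y, w x y = w y x) (φ : V → ℝ) :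
    ∑ x, (weightedLaplacian G w *ᵥ φ) x = 0 := by
  have h : ∑ x, (weightedLaplacian G w *ᵥ φ) x = -∑ x, (weightedLaplacian G w *ᵥ φ) x := by
    simp only [weightedLaplacian_mulVec]
    conv_lhs => rw [Finset.sum_comm]
    rw [← Finset.sum_neg_distrib]
    refine Finset.sum_congr rfl fun x _ => ?_
    rw [← Finset.sum_neg_distrib]
    refine Finset.sum_congr rfl fun y _ => ?_
    rw [conductance_comm G w hw]; ring
  linarith

theorem energy_eq {V : Type*} [Fintype V] (G : SimpleGraph V)
    (w : V → V → ℝ) (hw : ∀ x y, w x y = w y x) (φ : V → ℝ) :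
    2 * (φ ⬝ᵥ (weightedLaplacian G w *ᵥ φ)) =
      ∑ x, ∑ y, conductance G w x y * (φ x - φ y) ^ 2 := by
  have e : φ ⬝ᵥ (weightedLaplacian G w *ᵥ φ) =
      ∑ x, ∑ y, φ x * (conductance G w x y * (φ x - φ y)) := by
    simp only [dotProduct, weightedLaplacian_mulVec, Finset.mul_sum]
  have e' : φ ⬝ᵥ (weightedLaplacian G w *ᵥ φ) =
      ∑ x, ∑ y, φ y * (conductance G w x y * (φ y - φ x)) := by
    rw [e, Finset.sum_comm]
    refine Finset.sum_congr rfl fun x _ => Finset.sum_congr rfl fun y _ => ?_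
    rw [conductance_comm G w hw]
  rw [two_mul]
  nth_rewrite 1 [e]
  rw [e']
  simp only [← Finset.sum_add_distrib]
  refine Finset.sum_congr rfl fun x _ => Finset.sum_congr rfl fun y _ => ?_
  ring

/-- In a connected network with positive edge weights, a unit current flow exists between any two
vertices. -/
theorem exists_isUnitPotential {V : Type*} [Fintype V] (G : SimpleGraph V) (hG : G.Connected)
    (w : V → V → ℝ) (hw : ∀ x y, w x y = w y x) (hpos : ∀ x y, G.Adj x y → 0 < w x y) (u v : V) :
    ∃ φ, IsUnitPotential G w u v φ := by
  classical
  let M : (V → ℝ) →ₗ[ℝ] (V → ℝ) :=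
    { toFun := fun φ x => (weightedLaplacian G w *ᵥ φ) x + ∑ y, φ y
      map_add' := fun a b => by
        ext x; simp [Matrix.mulVec_add, Finset.sum_add_distrib]; ring
      map_smul' := fun a b => by
        ext x; simp [Matrix.mulVec_smul, ← Finset.mul_sum]; ring }
  have hM : ∀ φ x, M φ x = (weightedLaplacian G w *ᵥ φ) x + ∑ y, φ y := fun _ _ => rfl
  have hV : (0 : ℝ) < Fintype.card V := by
    exact_mod_cast Fintype.card_pos_iff.mpr ⟨u⟩
  have hsum : ∀ φ, ∑ x, M φ x = Fintype.card V * ∑ y, φ y := fun φ => by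
    simp only [hM, Finset.sum_add_distrib, sum_weightedLaplacian_mulVec G w hw, zero_add,
      Finset.sum_const, Finset.card_univ, nsmul_eq_mul]
  have hinj : Function.Injective M := by
    rw [← LinearMap.ker_eq_bot, LinearMap.ker_eq_bot']
    intro φ h0
    have hs : ∑ y, φ y = 0 := by
      have := hsum φ
      rw [h0] at this
      simpa [hV.ne', eq_comm] using this
    have hL : weightedLaplacian G w *ᵥ φ = 0 := by
      ext x
      have := congrFun h0 x
      rw [hM, hs, add_zero] at this
      exact this
    have hE := energy_eq G w hw φ
    rw [hL, dotProduct_zero, mul_zero] at hE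
    have hc : ∀ x y, 0 ≤ conductance G w x y := fun x y => by
      by_cases h : G.Adj x y
      · simpa [conductance, h] using (hpos x y h).le
      · simp [conductance, h]
    have hadj : ∀ x y, G.Adj x y → φ x = φ y := fun x y hxy => by
      have h1 := (Finset.sum_eq_zero_iff_of_nonneg (fun x _ => Finset.sum_nonneg
        fun y _ => mul_nonneg (hc x y) (sq_nonneg (φ x - φ y)))).mp hE.symm x (Finset.mem_univ x)
      have h2 := (Finset.sum_eq_zero_iff_of_nonneg
        fun y _ => mul_nonneg (hc x y) (sq_nonneg (φ x - φ y))).mp h1 y (Finset.mem_univ y)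
      have h3 : conductance G w x y ≠ 0 := by
        simpa [conductance, hxy] using (hpos x y hxy).ne'
      have h4 := (mul_eq_zero.mp h2).resolve_left h3
      exact sub_eq_zero.mp (pow_eq_zero_iff (two_ne_zero) |>.mp h4)
    have hconst : ∀ x y, φ x = φ y := fun x y => by
      obtain ⟨p⟩ := hG.preconnected x y
      induction p with
      | nil => rfl
      | cons h _ ih => exact (hadj _ _ h).trans ih
    ext x
    have : (Fintype.card V : ℝ) * φ x = 0 := by
      rw [← hs, Finset.sum_congr rfl fun y _ => hconst y x]
      simp
    simpa [hV.ne'] using this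
  obtain ⟨φ, hφ⟩ := (LinearMap.injective_iff_surjective.mp hinj)
    (Pi.single u 1 - Pi.single v 1)
  refine ⟨φ, ?_⟩
  have hs : ∑ y, φ y = 0 := by
    have := hsum φ
    rw [hφ] at this
    simpa [hV.ne', eq_comm] using this
  unfold IsUnitPotential
  rw [← hφ]
  ext x
  rw [hM, hs, add_zero]

/-! ### Generalized blow-up graphs -/

/-- The generalized join graph `H[G₁, …, G_k]`: every vertex `i` of `H` is replaced by the graph
`F i`, and all vertices of `F i` are joined to all vertices of `F j` whenever `ij` is an edge
of `H`. -/
def generalizedJoin {I : Type*} {W : I → Type*} (H : SimpleGraph I)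
    (F : (i : I) → SimpleGraph (W i)) : SimpleGraph (Σ i, W i) where
  Adj u v := H.Adj u.1 v.1 ∨ ∃ h : u.1 = v.1, (F v.1).Adj (h ▸ u.2) v.2
  symm := ⟨by
    rintro ⟨i, a⟩ ⟨j, b⟩ (h | ⟨h, h'⟩)
    · exact Or.inl h.symm
    · dsimp only at h
      subst h
      exact Or.inr ⟨rfl, h'.symm⟩⟩
  loopless := ⟨by
    rintro ⟨i, a⟩ (h | ⟨_, h⟩)
    · exact H.loopless.irrefl i h
    · exact (F i).loopless.irrefl a h⟩

/-- The graph `p K_t ∪ q K_1`, the disjoint union of `p` copies of the complete graph `K_t` (the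
vertices `(a, x)` of the `a`-th copy) and `q` isolated vertices. -/
def cliquesAndIsolated (t p q : ℕ) : SimpleGraph ((Fin p × Fin t) ⊕ Fin q) where
  Adj u v := ∃ a x y, x ≠ y ∧ u = Sum.inl (a, x) ∧ v = Sum.inl (a, y)
  symm := ⟨by
    rintro u v ⟨a, x, y, h, hu, hv⟩
    exact ⟨a, y, x, h.symm, hv, hu⟩⟩
  loopless := ⟨by
    rintro u ⟨a, x, y, h, hu, hv⟩
    rw [hu] at hv
    simp at hv
    exact h hv⟩

/-- The vertices of the generalized blow-up graph: a part index `i`, and a vertex of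
`p i K_t ∪ q i K_1`. -/
abbrev BlowUpVertex {k : ℕ} (t : ℕ) (p q : Fin k → ℕ) : Type :=
  Σ i : Fin k, (Fin (p i) × Fin t) ⊕ Fin (q i)

/-- The generalized blow-up graph of `H`. -/
def generalizedBlowUp {k : ℕ} (H : SimpleGraph (Fin k)) (t : ℕ) (p q : Fin k → ℕ) :
    SimpleGraph (BlowUpVertex t p q) :=
  generalizedJoin H fun i => cliquesAndIsolated t (p i) (q i)

/-- The vertices of the copies of `K_t` in part `i`. -/
def cliquePart {k : ℕ} (t : ℕ) (p q : Fin k → ℕ) (i : Fin k) : Set (BlowUpVertex t p q) :=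
  {u | ∃ a : Fin (p i) × Fin t, u = ⟨i, Sum.inl a⟩}

/-- The vertices of the copies of `K_1` in part `i`. -/
def isolatedPart {k : ℕ} (t : ℕ) (p q : Fin k → ℕ) (i : Fin k) : Set (BlowUpVertex t p q) :=
  {u | ∃ b : Fin (q i), u = ⟨i, Sum.inr b⟩}

/-- The number `n_i = t p_i + q_i` of vertices of part `i`. -/
def partSize {k : ℕ} (t : ℕ) (p q : Fin k → ℕ) (i : Fin k) : ℕ := t * p i + q i

open Classical in
/-- The sum of `n_a` over the neighbours `a` of `i` in `H`. -/
def nbrSum {k : ℕ} (H : SimpleGraph (Fin k)) (n : Fin k → ℕ) (i : Fin k) : ℕ :=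
  ∑ a ∈ H.neighborFinset i, n a

end

/-!
In a generalized join `H[F₁, …, F_k]` the Laplacian acts on a potential `φ` at a vertex of part `a`
as `N a * φ` plus the Laplacian of `F a`, minus the total of `φ` over the neighbouring parts; here
`N a` is the number of vertices in the neighbouring parts. A unit potential can therefore be
assembled from two kinds of pieces.

* A *local* solution `f` of `N i * f + L (F i) f = δ_u` on the part of `u`, extended by zero. The
  total of `f` is `1 / N i`, so its image under the Laplacian is `δ_u` minus `1 / N i` on every
  neighbouring part.
* Functions constant on the parts. On these the Laplacian of the join is, up to the factor `n a`,
  the Laplacian of `H` with weights `n a * n b`.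

For `u`, `v` in one part the difference of their local solutions is already a unit potential. For
different parts `i ≠ j`, subtracting `1 / (n i * N i)` on part `i` makes the leakage of the local
solution stay inside the part, spread as `-1 / n i`; the unit potential of the weighted graph `H`
then carries the current from part `i` to part `j`
(`resistanceDist_generalizedJoin_same`, `resistanceDist_generalizedJoin_ne`).

For `p K_t ∪ q K_1` the local solutions are explicit (`localGreen_eq`), which gives all
resistances. The Kirchhoff index follows by summing the resistances over the blocks of a pair of
parts (`sum_within_part`, `sum_between_parts`).
-/

/-! ### Symmetry of the resistance distance -/

theorem IsUnitPotential.neg {V : Type*} [Fintype V] {G : SimpleGraph V} {w : V → V → ℝ}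
    {u v : V} {φ : V → ℝ} (h : IsUnitPotential G w u v φ) : IsUnitPotential G w v u (-φ) := by
  unfold IsUnitPotential at *
  rw [Matrix.mulVec_neg, h, neg_sub]

theorem resistanceDistW_comm {V : Type*} [Fintype V] (G : SimpleGraph V) (w : V → V → ℝ)
    (hw : ∀ x y, w x y = w y x) (u v : V) :
    resistanceDistW G w u v = resistanceDistW G w v u := by
  by_cases h : ∃ φ, IsUnitPotential G w u v φ
  · obtain ⟨φ, hφ⟩ := h
    rw [resistanceDistW_eq G w hw hφ, resistanceDistW_eq G w hw hφ.neg, Pi.neg_apply, Pi.neg_apply]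
    ring
  · have h' : ¬ ∃ φ, IsUnitPotential G w v u φ := fun ⟨φ, hφ⟩ => h ⟨-φ, hφ.neg⟩
    rw [resistanceDistW, resistanceDistW, dif_neg h, dif_neg h']

theorem resistanceDist_comm {V : Type*} [Fintype V] (G : SimpleGraph V) (u v : V) :
    resistanceDist G u v = resistanceDist G v u :=
  resistanceDistW_comm G _ (fun _ _ => rfl) u v

theorem resistanceDist_self {V : Type*} [Fintype V] (G : SimpleGraph V) (u : V) :
    resistanceDist G u u = 0 := by
  have h : IsUnitPotential G (fun _ _ => 1) u u 0 := by
    unfold IsUnitPotential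
    rw [Matrix.mulVec_zero, sub_self]
  rw [resistanceDist, resistanceDistW_eq G _ (fun _ _ => rfl) h]
  simp

/-! ### Resistances in a generalized join -/

theorem conductance_eq_mul {V : Type*} (G : SimpleGraph V) (w : V → V → ℝ) (x y : V) :
    conductance G w x y = conductance G (fun _ _ => 1) x y * w x y := by
  by_cases h : G.Adj x y <;> simp [conductance, h]

theorem conductance_one_congr {V V' : Type*} {G : SimpleGraph V} {G' : SimpleGraph V'} {x y : V}
    {x' y' : V'} (h : G.Adj x y ↔ G'.Adj x' y') :
    conductance G (fun _ _ => 1) x y = conductance G' (fun _ _ => 1) x' y' := by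
  by_cases h' : G'.Adj x' y'
  · simp [conductance, h', h.mpr h']
  · simp [conductance, h', mt h.mp h']

theorem conductance_generalizedJoin {I : Type*} {W : I → Type*} [DecidableEq I]
    (H : SimpleGraph I) (F : (i : I) → SimpleGraph (W i)) (a b : I) (z : W a) (w : W b) :
    conductance (generalizedJoin H F) (fun _ _ => 1) ⟨a, z⟩ ⟨b, w⟩ =
      conductance H (fun _ _ => 1) a b +
        if h : a = b then conductance (F b) (fun _ _ => 1) (h ▸ z) w else 0 := by
  by_cases hab : a = b
  · subst hab
    have h : (generalizedJoin H F).Adj ⟨a, z⟩ ⟨a, w⟩ ↔ (F a).Adj z w :=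
      ⟨fun h => h.elim (fun h => absurd h (H.loopless.irrefl a)) fun ⟨_, h⟩ => h,
        fun h => Or.inr ⟨rfl, h⟩⟩
    have h0 : conductance H (fun _ _ => 1) a a = 0 := by simp [conductance]
    rw [h0, zero_add, dif_pos rfl, conductance_one_congr h]
  · have h : (generalizedJoin H F).Adj ⟨a, z⟩ ⟨b, w⟩ ↔ H.Adj a b :=
      ⟨fun h => h.elim id fun ⟨h, _⟩ => absurd h hab, Or.inl⟩
    rw [dif_neg hab, add_zero, conductance_one_congr h]

section Join

variable {I : Type*} [Fintype I] {W : I → Type*} [∀ i, Fintype (W i)]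

/-- The number of vertices, in a generalized join over `H`, of the parts adjacent to part `a`; it is
encoded as the total conductance at `a` of `H` with weight `|W b|` on the arc from `a` to `b`. -/
noncomputable def joinDegree (H : SimpleGraph I) (W : I → Type*) [∀ i, Fintype (W i)] (a : I) : ℝ :=
  ∑ b, conductance H (fun _ b => (Fintype.card (W b) : ℝ)) a b

/-- The Laplacian of a generalized join is the sum of a contribution of the edges between the
parts and the Laplacian of the part. -/
theorem weightedLaplacian_generalizedJoin (H : SimpleGraph I) (F : (i : I) → SimpleGraph (W i))
    (φ : (Σ i, W i) → ℝ) (a : I) (z : W a) :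
    (weightedLaplacian (generalizedJoin H F) (fun _ _ => 1) *ᵥ φ) ⟨a, z⟩ =
      ∑ b, conductance H (fun _ _ => 1) a b * ∑ w, (φ ⟨a, z⟩ - φ ⟨b, w⟩) +
        (weightedLaplacian (F a) (fun _ _ => 1) *ᵥ fun w => φ ⟨a, w⟩) z := by
  classical
  rw [weightedLaplacian_mulVec, weightedLaplacian_mulVec, Fintype.sum_sigma]
  simp only [conductance_generalizedJoin, add_mul, Finset.sum_add_distrib, Finset.mul_sum]
  congr 1
  rw [Finset.sum_eq_single a]
  · simp
  · intro b _ hb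
    simp [hb.symm]
  · simp

/-- A solution of the local equation on part `i` with source `g`, extended by zero, has the source
`g` on part `i` and drains the current `(∑ w, g w) / N i` at every vertex of the neighbouring
parts. -/
theorem weightedLaplacian_local [DecidableEq I] (H : SimpleGraph I)
    (F : (i : I) → SimpleGraph (W i)) {i : I} (hN : joinDegree H W i ≠ 0) {f g : W i → ℝ}
    (hf : ∀ z, joinDegree H W i * f z + (weightedLaplacian (F i) (fun _ _ => 1) *ᵥ f) z = g z)
    (a : I) (z : W a) :
    (weightedLaplacian (generalizedJoin H F) (fun _ _ => 1) *ᵥ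
        fun x => (Pi.single i f : (a : I) → W a → ℝ) x.1 x.2) ⟨a, z⟩ =
      (Pi.single i g : (a : I) → W a → ℝ) a z
        - conductance H (fun _ _ => 1) a i * ((∑ w, g w) / joinDegree H W i) := by
  have hsum : ∑ w, f w = (∑ w, g w) / joinDegree H W i := by
    rw [eq_div_iff hN, mul_comm]
    simp only [← hf, Finset.sum_add_distrib, ← Finset.mul_sum,
      sum_weightedLaplacian_mulVec (F i) (fun _ _ => 1) (fun _ _ => rfl), add_zero]
  rw [weightedLaplacian_generalizedJoin, ← hsum]
  have hout : ∑ b, conductance H (fun _ _ => 1) a b *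
      ∑ w : W b, (Pi.single i f : (a : I) → W a → ℝ) b w =
      conductance H (fun _ _ => 1) a i * ∑ w, f w := by
    rw [Finset.sum_eq_single i]
    · simp
    · intro b _ hb
      simp [Pi.single_eq_of_ne hb]
    · simp
  simp only [Finset.sum_sub_distrib, mul_sub, hout, Finset.sum_const, Finset.card_univ,
    nsmul_eq_mul]
  by_cases ha : a = i
  · subst ha
    simp only [Pi.single_eq_same, ← hf, joinDegree]
    simp only [← mul_assoc, ← Finset.sum_mul,
      conductance_eq_mul H (fun _ b => (Fintype.card (W b) : ℝ))]
    have : (fun w => f w) = f := rfl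
    rw [this]
    ring
  · have h0 : (weightedLaplacian (F a) (fun _ _ => 1) *ᵥ fun _ => (0 : ℝ)) z = 0 := by
      rw [weightedLaplacian_mulVec]
      simp
    simp [Pi.single_eq_of_ne ha, h0]

/-- On functions that are constant on the parts, the Laplacian of a generalized join is, up to the
sizes of the parts, the Laplacian of `H` with weights `|W a| * |W b|`. -/
theorem card_mul_weightedLaplacian_comp_fst (H : SimpleGraph I)
    (F : (i : I) → SimpleGraph (W i)) (ψ : I → ℝ) (a : I) (z : W a) :
    (Fintype.card (W a) : ℝ) *
      (weightedLaplacian (generalizedJoin H F) (fun _ _ => 1) *ᵥ fun x => ψ x.1) ⟨a, z⟩ =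
      (weightedLaplacian H (fun x y => (Fintype.card (W x) : ℝ) * Fintype.card (W y)) *ᵥ ψ) a := by
  have h0 : (weightedLaplacian (F a) (fun _ _ => 1) *ᵥ fun _ => ψ a) z = 0 := by
    rw [weightedLaplacian_mulVec]
    simp
  rw [weightedLaplacian_generalizedJoin, h0, weightedLaplacian_mulVec, add_zero, Finset.mul_sum]
  refine Finset.sum_congr rfl fun b _ => ?_
  rw [conductance_eq_mul H (fun x y => (Fintype.card (W x) : ℝ) * Fintype.card (W y))]
  simp only [Finset.sum_const, Finset.card_univ, nsmul_eq_mul]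
  ring

theorem weightedLaplacian_indicator_fst [DecidableEq I] (H : SimpleGraph I)
    (F : (i : I) → SimpleGraph (W i)) (i : I) (c : ℝ) (a : I) (z : W a) :
    (weightedLaplacian (generalizedJoin H F) (fun _ _ => 1) *ᵥ
        fun x => (Pi.single i c : I → ℝ) x.1) ⟨a, z⟩ =
      (Pi.single i (joinDegree H W i * c) : I → ℝ) a
        - conductance H (fun _ _ => 1) a i * (Fintype.card (W i) * c) := by
  have h0 : (weightedLaplacian (F a) (fun _ _ => 1) *ᵥ
      fun _ => (Pi.single i c : I → ℝ) a) z = 0 := by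
    rw [weightedLaplacian_mulVec]
    simp
  rw [weightedLaplacian_generalizedJoin, h0, add_zero]
  simp only [Finset.sum_sub_distrib, mul_sub, Finset.sum_const, Finset.card_univ, nsmul_eq_mul]
  congr 1
  · simp only [← mul_assoc, ← Finset.sum_mul, joinDegree,
      conductance_eq_mul H (fun _ b => (Fintype.card (W b) : ℝ))]
    by_cases ha : a = i
    · subst ha; simp
    · simp [Pi.single_eq_of_ne ha]
  · rw [Finset.sum_eq_single i]
    · simp
    · intro b _ hb
      simp [Pi.single_eq_of_ne hb]
    · simp

/-- Within a part, the leakages of the two local solutions `f` and `g` into the neighbouring parts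
cancel, so `f - g` extended by zero is a unit potential. -/
theorem resistanceDist_generalizedJoin_same (H : SimpleGraph I)
    (F : (i : I) → SimpleGraph (W i)) [∀ i, DecidableEq (W i)]
    {i : I} (hN : joinDegree H W i ≠ 0) {u v : W i} {f g : W i → ℝ}
    (hf : ∀ z, joinDegree H W i * f z + (weightedLaplacian (F i) (fun _ _ => 1) *ᵥ f) z =
      (Pi.single u 1 : W i → ℝ) z)
    (hg : ∀ z, joinDegree H W i * g z + (weightedLaplacian (F i) (fun _ _ => 1) *ᵥ g) z =
      (Pi.single v 1 : W i → ℝ) z) :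
    resistanceDist (generalizedJoin H F) ⟨i, u⟩ ⟨i, v⟩ = f u - g u - (f v - g v) := by
  classical
  have key : IsUnitPotential (generalizedJoin H F) (fun _ _ => 1) ⟨i, u⟩ ⟨i, v⟩
      (fun x => (Pi.single i (f - g) : (a : I) → W a → ℝ) x.1 x.2) := by
    unfold IsUnitPotential
    ext ⟨a, z⟩
    rw [weightedLaplacian_local H F hN (g := Pi.single u 1 - Pi.single v 1)]
    · by_cases ha : a = i
      · subst ha
        simp [Pi.single_apply]
      · simp [Pi.single_apply, ha]
    · intro z
      rw [Matrix.mulVec_sub, Pi.sub_apply, Pi.sub_apply, Pi.sub_apply, ← hf, ← hg]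
      ring
  rw [resistanceDist, resistanceDistW_eq _ _ (fun _ _ => rfl) key]
  simp

/-- The unit potential is `f`, extended by zero and shifted by a constant on part `i`, minus the
same for `g` on part `j`, plus the unit potential of `H` with weights `|W a| * |W b|`. -/
theorem resistanceDist_generalizedJoin_ne (H : SimpleGraph I) (hH : H.Connected)
    (F : (i : I) → SimpleGraph (W i)) [∀ i, Nonempty (W i)] [∀ i, DecidableEq (W i)]
    {i j : I} (hij : i ≠ j) (hNi : joinDegree H W i ≠ 0) (hNj : joinDegree H W j ≠ 0)
    {u : W i} {v : W j} {f : W i → ℝ} {g : W j → ℝ}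
    (hf : ∀ z, joinDegree H W i * f z + (weightedLaplacian (F i) (fun _ _ => 1) *ᵥ f) z =
      (Pi.single u 1 : W i → ℝ) z)
    (hg : ∀ z, joinDegree H W j * g z + (weightedLaplacian (F j) (fun _ _ => 1) *ᵥ g) z =
      (Pi.single v 1 : W j → ℝ) z) :
    resistanceDist (generalizedJoin H F) ⟨i, u⟩ ⟨j, v⟩ =
      vertexResistanceDist H (fun a => (Fintype.card (W a) : ℝ)) i j + (f u + g v
        + -1 / (Fintype.card (W i) * joinDegree H W i)
        + -1 / (Fintype.card (W j) * joinDegree H W j)) := by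
  classical
  have hc : ∀ a, (0 : ℝ) < Fintype.card (W a) := fun a => by
    exact_mod_cast Fintype.card_pos
  have hsymm : ∀ x y, (Fintype.card (W x) : ℝ) * Fintype.card (W y) =
      Fintype.card (W y) * Fintype.card (W x) := fun x y => mul_comm _ _
  obtain ⟨ψ, hψ⟩ := exists_isUnitPotential H hH _ hsymm
    (fun x y _ => mul_pos (hc x) (hc y)) i j
  have hR : vertexResistanceDist H (fun a => (Fintype.card (W a) : ℝ)) i j = ψ i - ψ j :=
    resistanceDistW_eq H _ hsymm hψ
  set si : ℝ := -1 / (Fintype.card (W i) * joinDegree H W i) with hsi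
  set sj : ℝ := -1 / (Fintype.card (W j) * joinDegree H W j) with hsj
  have key : IsUnitPotential (generalizedJoin H F) (fun _ _ => 1) ⟨i, u⟩ ⟨j, v⟩
      ((fun x => (Pi.single i f : (a : I) → W a → ℝ) x.1 x.2)
        - (fun x => (Pi.single j g : (a : I) → W a → ℝ) x.1 x.2) + (fun x => ψ x.1)
        + (fun x => (Pi.single i si : I → ℝ) x.1) - (fun x => (Pi.single j sj : I → ℝ) x.1)) := by
    unfold IsUnitPotential at hψ ⊢
    ext ⟨a, z⟩
    have hψa := card_mul_weightedLaplacian_comp_fst H F ψ a z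
    rw [hψ, mul_comm, ← eq_div_iff (hc a).ne'] at hψa
    simp only [Matrix.mulVec_add, Matrix.mulVec_sub, Pi.add_apply, Pi.sub_apply]
    rw [weightedLaplacian_local H F hNi hf, weightedLaplacian_local H F hNj hg, hψa,
      weightedLaplacian_indicator_fst, weightedLaplacian_indicator_fst]
    -- The leakage of each local solution is cancelled by the constant shift of its part.
    have e : ∀ l, joinDegree H W l ≠ 0 → (Fintype.card (W l) : ℝ) *
        (-1 / (Fintype.card (W l) * joinDegree H W l)) = -(1 / joinDegree H W l) := fun l hl => by
      have := (hc l).ne'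
      field_simp
    have e' : ∀ l, joinDegree H W l ≠ 0 → joinDegree H W l *
        (-1 / (Fintype.card (W l) * joinDegree H W l)) = -(1 / Fintype.card (W l) : ℝ) :=
      fun l hl => by
        have := (hc l).ne'
        field_simp
    rw [hsi, hsj, e i hNi, e j hNj, e' i hNi, e' j hNj]
    by_cases hi : a = i
    · subst hi
      simp [Pi.single_apply, hij]
      ring
    · by_cases hj : a = j
      · subst hj
        simp [Pi.single_apply, hi]
        ring
      · simp [Pi.single_apply, hi, hj]
  rw [resistanceDist, resistanceDistW_eq _ _ (fun _ _ => rfl) key, hR]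
  simp [Pi.single_eq_of_ne hij, Pi.single_eq_of_ne hij.symm]
  ring

end Join

/-! ### Local solutions on a disjoint union of cliques and isolated vertices -/

/-- The solution with source `u` of the local equation `N * f + L f = δ_u` on `p K_t ∪ q K_1`. It is
supported on the component of `u`. -/
noncomputable def localGreen (t p q : ℕ) (N : ℝ) (u : (Fin p × Fin t) ⊕ Fin q) :
    (Fin p × Fin t) ⊕ Fin q → ℝ :=
  match u with
  | Sum.inl (c, x) => Sum.elim
      (fun d => if d.1 = c then ((if d.2 = x then 1 else 0) + 1 / N) / (N + t) else 0) fun _ => 0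
  | Sum.inr b => Sum.elim (fun _ => 0) fun b' => if b' = b then 1 / N else 0

theorem weightedLaplacian_cliques_inl (t p q : ℕ) (f : (Fin p × Fin t) ⊕ Fin q → ℝ)
    (c : Fin p) (x : Fin t) :
    (weightedLaplacian (cliquesAndIsolated t p q) (fun _ _ => 1) *ᵥ f) (Sum.inl (c, x)) =
      ∑ y, (f (Sum.inl (c, x)) - f (Sum.inl (c, y))) := by
  classical
  rw [weightedLaplacian_mulVec, Fintype.sum_sum_type, Fintype.sum_prod_type,
    Finset.sum_eq_single c]
  · have h : ∀ b : Fin q, conductance (cliquesAndIsolated t p q) (fun _ _ => 1)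
        (Sum.inl (c, x)) (Sum.inr b) = 0 := fun b => by
      simp [conductance, cliquesAndIsolated]
    simp only [h, zero_mul, Finset.sum_const_zero, add_zero]
    refine Finset.sum_congr rfl fun y _ => ?_
    by_cases hxy : x = y
    · simp [hxy]
    · have : (cliquesAndIsolated t p q).Adj (Sum.inl (c, x)) (Sum.inl (c, y)) :=
        ⟨c, x, y, hxy, rfl, rfl⟩
      simp [conductance, this]
  · intro d _ hd
    refine Finset.sum_eq_zero fun y _ => ?_
    have : ¬ (cliquesAndIsolated t p q).Adj (Sum.inl (c, x)) (Sum.inl (d, y)) := by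
      rintro ⟨a, x', y', -, h1, h2⟩
      simp only [Sum.inl.injEq, Prod.mk.injEq] at h1 h2
      exact hd (h2.1.trans h1.1.symm)
    simp [conductance, this]
  · simp

theorem weightedLaplacian_cliques_inr (t p q : ℕ) (f : (Fin p × Fin t) ⊕ Fin q → ℝ)
    (b : Fin q) :
    (weightedLaplacian (cliquesAndIsolated t p q) (fun _ _ => 1) *ᵥ f) (Sum.inr b) = 0 := by
  rw [weightedLaplacian_mulVec]
  refine Finset.sum_eq_zero fun y _ => ?_
  simp [conductance, cliquesAndIsolated]

theorem localGreen_eq (t p q : ℕ) {N : ℝ} (hN : 0 < N) (u z : (Fin p × Fin t) ⊕ Fin q) :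
    N * localGreen t p q N u z +
      (weightedLaplacian (cliquesAndIsolated t p q) (fun _ _ => 1) *ᵥ localGreen t p q N u) z =
      (Pi.single u 1 : (Fin p × Fin t) ⊕ Fin q → ℝ) z := by
  have hNt : N + t ≠ 0 := by positivity
  rcases z with ⟨d, y⟩ | b'
  · rw [weightedLaplacian_cliques_inl]
    rcases u with ⟨c, x⟩ | b
    · by_cases hd : d = c
      · subst hd
        simp only [localGreen, Sum.elim_inl, if_true, Finset.sum_sub_distrib, Finset.sum_const,
          Finset.card_univ, Fintype.card_fin, nsmul_eq_mul, ← Finset.sum_div,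
          Finset.sum_add_distrib, Finset.sum_ite_eq', Finset.mem_univ, Pi.single_apply,
          Sum.inl.injEq, Prod.mk.injEq, true_and]
        have := hN.ne'
        field_simp
        ring
      · simp [localGreen, hd]
    · simp [localGreen]
  · rw [weightedLaplacian_cliques_inr]
    rcases u with ⟨c, x⟩ | b
    · simp [localGreen]
    · have := hN.ne'
      by_cases hb : b' = b <;> simp [localGreen, hb, this]

/-! ### Sums over pairs of vertices -/

theorem sum_sum_eq_sum_diag_add_two_mul {k : ℕ} (T : Fin k → Fin k → ℝ)
    (hT : ∀ i j, T i j = T j i) :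
    ∑ i, ∑ j, T i j = ∑ i, T i i + 2 * ∑ i, ∑ j ∈ Finset.Ioi i, T i j := by
  have h : ∀ i, ∑ j, T i j =
      T i i + ∑ j ∈ Finset.Ioi i, T i j + ∑ j, if j < i then T i j else 0 := fun i => by
    rw [← Finset.sum_filter, show Finset.Ioi i = Finset.univ.filter (i < ·) by ext; simp,
      Finset.sum_filter, Finset.sum_filter,
      show T i i = ∑ j, if j = i then T i j else 0 by simp,
      ← Finset.sum_add_distrib, ← Finset.sum_add_distrib]
    refine Finset.sum_congr rfl fun j _ => ?_
    rcases lt_trichotomy i j with h | h | h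
    · simp [h, h.ne', h.not_gt]
    · simp [h]
    · simp [h, h.ne, h.not_gt]
  have h' : ∑ i, ∑ j, (if j < i then T i j else 0) = ∑ i, ∑ j ∈ Finset.Ioi i, T i j := by
    rw [Finset.sum_comm]
    refine Finset.sum_congr rfl fun i _ => ?_
    rw [← Finset.sum_filter, show Finset.Ioi i = Finset.univ.filter (i < ·) by ext; simp]
    exact Finset.sum_congr rfl fun j _ => hT j i
  simp only [h, Finset.sum_add_distrib, h']
  ring

theorem sum_eq_of_eq_off_diag {n : ℕ} {f : Fin n → ℝ} {x : Fin n} {c : ℝ}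
    (hf : ∀ y, y ≠ x → f y = c) : ∑ y, f y = f x + (n - 1) * c := by
  rw [Fintype.sum_eq_add_sum_compl x, Finset.sum_congr rfl fun y hy => hf y (by simpa using hy),
    Finset.sum_const, Finset.card_compl, Finset.card_singleton, Fintype.card_fin, nsmul_eq_mul,
    Nat.cast_sub (Fin.pos x), Nat.cast_one]

/-- Half the sum over ordered pairs in `p K_t ∪ q K_1`; the four constants are the values on two
isolated vertices, on a clique vertex and an isolated vertex, on two vertices of one clique, and on
two vertices of different cliques. -/
theorem sum_within_part {t p q : ℕ} {R : (Fin p × Fin t) ⊕ Fin q → (Fin p × Fin t) ⊕ Fin q → ℝ}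
    {r₁ r₂ r₃ r₄ : ℝ} (h0 : ∀ u, R u u = 0)
    (h1 : ∀ b b', b' ≠ b → R (Sum.inr b) (Sum.inr b') = r₁)
    (h2 : ∀ d b, R (Sum.inl d) (Sum.inr b) = r₂) (h2' : ∀ b d, R (Sum.inr b) (Sum.inl d) = r₂)
    (h3 : ∀ c x y, y ≠ x → R (Sum.inl (c, x)) (Sum.inl (c, y)) = r₃)
    (h4 : ∀ c d x y, d ≠ c → R (Sum.inl (c, x)) (Sum.inl (d, y)) = r₄) :
    (∑ u, ∑ v, R u v) / 2 = (q.choose 2 : ℝ) * r₁ + (p : ℝ) * q * t * r₂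
        + (t.choose 2 : ℝ) * p * r₃ + (p.choose 2 : ℝ) * (t : ℝ) ^ 2 * r₄ := by
  have e1 : ∀ b, ∑ b', R (Sum.inr b) (Sum.inr b') = (q - 1) * r₁ := fun b => by
    rw [sum_eq_of_eq_off_diag (h1 b), h0, zero_add]
  have e2 : ∀ c x, ∑ d : Fin p, ∑ y : Fin t, R (Sum.inl (c, x)) (Sum.inl (d, y)) =
      (t - 1) * r₃ + (p - 1) * (t * r₄) := fun c x => by
    rw [sum_eq_of_eq_off_diag (x := c) (c := t * r₄), sum_eq_of_eq_off_diag (h3 c x), h0, zero_add]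
    intro d hd
    rw [Finset.sum_congr rfl fun y _ => h4 c d x y hd]
    simp
  simp only [Fintype.sum_sum_type, Fintype.sum_prod_type, e1, e2, h2, h2', Finset.sum_const,
    Finset.card_univ, Fintype.card_prod, Fintype.card_fin, nsmul_eq_mul, Nat.cast_mul,
    Nat.cast_choose_two]
  ring

theorem sum_between_parts {t p q p' q' : ℕ}
    {R : (Fin p × Fin t) ⊕ Fin q → (Fin p' × Fin t) ⊕ Fin q' → ℝ}
    {r₅ r₆ r₇ r₈ : ℝ} (h5 : ∀ b b', R (Sum.inr b) (Sum.inr b') = r₅)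
    (h6 : ∀ b d, R (Sum.inr b) (Sum.inl d) = r₆) (h7 : ∀ d b, R (Sum.inl d) (Sum.inr b) = r₇)
    (h8 : ∀ d d', R (Sum.inl d) (Sum.inl d') = r₈) :
    ∑ u, ∑ v, R u v = (q : ℝ) * ((q' : ℝ) * r₅ + (p' : ℝ) * t * r₆)
      + (p : ℝ) * ((q' : ℝ) * t * r₇ + (p' : ℝ) * (t : ℝ) ^ 2 * r₈) := by
  simp only [Fintype.sum_sum_type, h5, h6, h7, h8, Finset.sum_const,
    Finset.card_univ, Fintype.card_prod, Fintype.card_fin, nsmul_eq_mul, Nat.cast_mul]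
  ring

/-! ### Generalized blow-up graphs -/

section BlowUp

variable {k : ℕ} (H : SimpleGraph (Fin k)) (t : ℕ) (p q : Fin k → ℕ)

theorem card_part (i : Fin k) :
    Fintype.card ((Fin (p i) × Fin t) ⊕ Fin (q i)) = partSize t p q i := by
  simp [partSize, mul_comm]

theorem joinDegree_blowUp (i : Fin k) :
    joinDegree H (fun i => (Fin (p i) × Fin t) ⊕ Fin (q i)) i =
      (nbrSum H (partSize t p q) i : ℝ) := by
  classical
  rw [joinDegree, nbrSum, Nat.cast_sum, SimpleGraph.neighborFinset_eq_filter, Finset.sum_filter]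
  refine Finset.sum_congr rfl fun b _ => ?_
  simp only [conductance, Matrix.of_apply, card_part]

variable {H t p q}

theorem nbrSum_pos (hk : 2 ≤ k) (hH : H.Connected) (hn : ∀ i, 1 ≤ partSize t p q i) (i : Fin k) :
    (0 : ℝ) < nbrSum H (partSize t p q) i := by
  classical
  have : Nontrivial (Fin k) := Fin.nontrivial_iff_two_le.mpr hk
  obtain ⟨j, hj⟩ := hH.preconnected.exists_adj_of_nontrivial i
  have h : 0 < nbrSum H (partSize t p q) i :=
    Finset.sum_pos (fun a _ => hn a) ⟨j, by simpa using hj⟩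
  exact_mod_cast h

theorem resistanceDist_blowUp_same (i : Fin k) (hN : (0 : ℝ) < nbrSum H (partSize t p q) i)
    (u v : (Fin (p i) × Fin t) ⊕ Fin (q i)) :
    resistanceDist (generalizedBlowUp H t p q) ⟨i, u⟩ ⟨i, v⟩ =
      localGreen t (p i) (q i) (nbrSum H (partSize t p q) i) u u
        - localGreen t (p i) (q i) (nbrSum H (partSize t p q) i) v u
        - (localGreen t (p i) (q i) (nbrSum H (partSize t p q) i) u v
          - localGreen t (p i) (q i) (nbrSum H (partSize t p q) i) v v) := by
  have hJ := joinDegree_blowUp H t p q i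
  refine resistanceDist_generalizedJoin_same H _ (by rw [hJ]; exact hN.ne')
    (fun z => ?_) (fun z => ?_)
  all_goals rw [hJ]; exact localGreen_eq t (p i) (q i) hN _ z

theorem resistanceDist_blowUp_ne (hk : 2 ≤ k) (hH : H.Connected)
    (hn : ∀ i, 1 ≤ partSize t p q i) {i j : Fin k} (hij : i ≠ j)
    (u : (Fin (p i) × Fin t) ⊕ Fin (q i)) (v : (Fin (p j) × Fin t) ⊕ Fin (q j)) :
    resistanceDist (generalizedBlowUp H t p q) ⟨i, u⟩ ⟨j, v⟩ =
      vertexResistanceDist H (fun a => (partSize t p q a : ℝ)) i j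
        + (localGreen t (p i) (q i) (nbrSum H (partSize t p q) i) u u
        + localGreen t (p j) (q j) (nbrSum H (partSize t p q) j) v v
        + -1 / (partSize t p q i * nbrSum H (partSize t p q) i)
        + -1 / (partSize t p q j * nbrSum H (partSize t p q) j)) := by
  have hN := nbrSum_pos hk hH hn
  have hne : ∀ a, Nonempty ((Fin (p a) × Fin t) ⊕ Fin (q a)) := fun a =>
    Fintype.card_pos_iff.mp (by rw [card_part]; exact hn a)
  have hJ := joinDegree_blowUp H t p q
  have h := resistanceDist_generalizedJoin_ne H hH
    (fun i => cliquesAndIsolated t (p i) (q i)) hij (by rw [hJ]; exact (hN i).ne')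
    (by rw [hJ]; exact (hN j).ne')
    (fun z => by rw [hJ]; exact localGreen_eq t (p i) (q i) (hN i) u z)
    (fun z => by rw [hJ]; exact localGreen_eq t (p j) (q j) (hN j) v z)
  simpa only [hJ, card_part, generalizedBlowUp] using h

/-- Every edge inside a part lies in one of the copies of `K_t`. -/
theorem generalizedBlowUp_adj_inl (i : Fin k) (c d : Fin (p i)) (x y : Fin t) :
    (generalizedBlowUp H t p q).Adj ⟨i, Sum.inl (c, x)⟩ ⟨i, Sum.inl (d, y)⟩ ↔ c = d ∧ x ≠ y := by
  constructor
  · rintro (h | ⟨_, a, x', y', hxy, h1, h2⟩)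
    · exact absurd h (H.loopless.irrefl i)
    · simp only [Sum.inl.injEq, Prod.mk.injEq] at h1 h2
      obtain ⟨rfl, rfl⟩ := h1
      obtain ⟨rfl, rfl⟩ := h2
      exact ⟨rfl, hxy⟩
  · rintro ⟨rfl, hxy⟩
    exact Or.inr ⟨rfl, c, x, y, hxy, rfl, rfl⟩

/-- With `r = 1 / N`, the potential at a source in a clique is `r (r + 1) / (t r + 1)`. -/
theorem localGreen_inl_self {N : ℝ} (hN : 0 < N) {p q : ℕ} (d : Fin p × Fin t) :
    localGreen t p q N (Sum.inl d) (Sum.inl d) = 1 / N * (1 / N + 1) / (t * (1 / N) + 1) := by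
  have h1 : N + t ≠ 0 := by positivity
  have h2 : t * (1 / N) + 1 ≠ 0 := by positivity
  have := hN.ne'
  simp only [localGreen, Sum.elim_inl, if_true]
  field_simp
  ring

theorem localGreen_inr_self (N : ℝ) {p q : ℕ} (b : Fin q) :
    localGreen t p q N (Sum.inr b) (Sum.inr b) = 1 / N := by
  simp [localGreen]

end BlowUp

theorem mainTheorem2 (k t : ℕ) (hk : 2 ≤ k) (ht : 1 ≤ t)
    (H : SimpleGraph (Fin k)) (hH : H.Connected) (p q : Fin k → ℕ)
    (hn : ∀ i, 1 ≤ partSize t p q i) :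
    let G := generalizedBlowUp H t p q
    let R := resistanceDist G
    let P := cliquePart t p q
    let Q := isolatedPart t p q
    let n : Fin k → ℝ := fun i => (partSize t p q i : ℝ)
    let RH := vertexResistanceDist H n
    let N : Fin k → ℝ := fun i => (nbrSum H (partSize t p q) i : ℝ)
    let r : Fin k → ℝ := fun i => 1 / N i
    let s : Fin k → ℝ := fun i => -1 / (n i * N i)
    let r₁ : Fin k → ℝ := fun i => 2 * r i
    let r₂ : Fin k → ℝ := fun i => r i * (r i + 1) / (t * r i + 1) + r i
    let r₃ : Fin k → ℝ := fun i => 2 * r i / (t * r i + 1)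
    let r₄ : Fin k → ℝ := fun i => 2 * r i * (r i + 1) / (t * r i + 1)
    let r₅ : Fin k → Fin k → ℝ := fun i j => RH i j + (r i + r j + s i + s j)
    let r₆ : Fin k → Fin k → ℝ := fun i j =>
      RH i j + (r i + r j * (r j + 1) / (t * r j + 1) + s i + s j)
    let r₇ : Fin k → Fin k → ℝ := fun i j =>
      RH i j + (r i * (r i + 1) / (t * r i + 1) + r j + s i + s j)
    let r₈ : Fin k → Fin k → ℝ := fun i j =>
      RH i j + (r i * (r i + 1) / (t * r i + 1) + r j * (r j + 1) / (t * r j + 1) + s i + s j)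
    (∀ (i : Fin k) (u v : BlowUpVertex t p q), u ≠ v →
      (u ∈ Q i → v ∈ Q i → R u v = r₁ i) ∧
      (u ∈ P i → v ∈ Q i → R u v = r₂ i) ∧
      (u ∈ P i → v ∈ P i → G.Adj u v → R u v = r₃ i) ∧
      (u ∈ P i → v ∈ P i → ¬ G.Adj u v → R u v = r₄ i)) ∧
    (∀ (i j : Fin k), i ≠ j → ∀ u v : BlowUpVertex t p q,
      (u ∈ Q i → v ∈ Q j → R u v = r₅ i j) ∧
      (u ∈ Q i → v ∈ P j → R u v = r₆ i j) ∧
      (u ∈ P i → v ∈ Q j → R u v = r₇ i j) ∧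
      (u ∈ P i → v ∈ P j → R u v = r₈ i j)) ∧
    kirchhoffIndex G =
      ∑ i, (((q i).choose 2 : ℝ) * r₁ i + (p i : ℝ) * q i * t * r₂ i
        + (t.choose 2 : ℝ) * p i * r₃ i + ((p i).choose 2 : ℝ) * (t : ℝ) ^ 2 * r₄ i)
      + ∑ i, ((q i : ℝ) * ∑ j ∈ Finset.Ioi i, ((q j : ℝ) * r₅ i j + (p j : ℝ) * t * r₆ i j)
        + (p i : ℝ) * ∑ j ∈ Finset.Ioi i,
            ((q j : ℝ) * t * r₇ i j + (p j : ℝ) * (t : ℝ) ^ 2 * r₈ i j)) := by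
  intro G R P Q n RH N r s r₁ r₂ r₃ r₄ r₅ r₆ r₇ r₈
  have hN : ∀ i, 0 < N i := nbrSum_pos hk hH hn
  have hR : ∀ u v, R u v = R v u := resistanceDist_comm G
  have h1 : ∀ i b b', b' ≠ b → R ⟨i, Sum.inr b⟩ ⟨i, Sum.inr b'⟩ = r₁ i := fun i b b' hb => by
    refine (resistanceDist_blowUp_same i (hN i) _ _).trans ?_
    simp only [localGreen, Sum.elim_inr, if_true, if_neg hb, if_neg hb.symm, r₁, r, N]
    ring
  have h2 : ∀ i d b, R ⟨i, Sum.inl d⟩ ⟨i, Sum.inr b⟩ = r₂ i := fun i d b => by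
    refine (resistanceDist_blowUp_same i (hN i) _ _).trans ?_
    rw [localGreen_inl_self (hN i), localGreen_inr_self]
    simp only [localGreen, Sum.elim_inl, Sum.elim_inr, r₂, r, N]
    ring
  have h3 : ∀ i c x y, y ≠ x →
      R ⟨i, Sum.inl (c, x)⟩ ⟨i, Sum.inl (c, y)⟩ = r₃ i := fun i c x y hxy => by
    refine (resistanceDist_blowUp_same i (hN i) _ _).trans ?_
    have hNi := hN i
    have e1 : N i + t ≠ 0 := by positivity
    have e2 : t * (1 / N i) + 1 ≠ 0 := by positivity
    have e3 := hNi.ne'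
    simp only [localGreen, Sum.elim_inl, if_true, if_neg hxy, if_neg hxy.symm, r₃, r]
    -- `localGreen` is evaluated at `nbrSum`, of which `N` is the abbreviation.
    change (1 + 1 / N i) / (N i + t) - (0 + 1 / N i) / (N i + t)
      - ((0 + 1 / N i) / (N i + t) - (1 + 1 / N i) / (N i + t)) = _
    field_simp
    ring
  have h4 : ∀ i c d x y, d ≠ c →
      R ⟨i, Sum.inl (c, x)⟩ ⟨i, Sum.inl (d, y)⟩ = r₄ i := fun i c d x y hcd => by
    refine (resistanceDist_blowUp_same i (hN i) _ _).trans ?_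
    rw [localGreen_inl_self (hN i), localGreen_inl_self (hN i)]
    simp only [localGreen, Sum.elim_inl, if_neg hcd, if_neg hcd.symm, r₄, r, N]
    ring
  have hb : ∀ i j, i ≠ j → ∀ u v, R ⟨i, u⟩ ⟨j, v⟩ = RH i j +
      (localGreen t (p i) (q i) (N i) u u + localGreen t (p j) (q j) (N j) v v + s i + s j) :=
    fun i j hij u v => resistanceDist_blowUp_ne hk hH hn hij u v
  have h5 : ∀ i j, i ≠ j → ∀ b b', R ⟨i, Sum.inr b⟩ ⟨j, Sum.inr b'⟩ = r₅ i j :=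
    fun i j hij b b' => by rw [hb i j hij, localGreen_inr_self, localGreen_inr_self]
  have h6 : ∀ i j, i ≠ j → ∀ b d, R ⟨i, Sum.inr b⟩ ⟨j, Sum.inl d⟩ = r₆ i j :=
    fun i j hij b d => by rw [hb i j hij, localGreen_inr_self, localGreen_inl_self (hN j)]
  have h7 : ∀ i j, i ≠ j → ∀ d b, R ⟨i, Sum.inl d⟩ ⟨j, Sum.inr b⟩ = r₇ i j :=
    fun i j hij d b => by rw [hb i j hij, localGreen_inr_self, localGreen_inl_self (hN i)]
  have h8 : ∀ i j, i ≠ j → ∀ d d', R ⟨i, Sum.inl d⟩ ⟨j, Sum.inl d'⟩ = r₈ i j :=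
    fun i j hij d d' => by
      rw [hb i j hij, localGreen_inl_self (hN i), localGreen_inl_self (hN j)]
  refine ⟨fun i u v huv => ⟨?_, ?_, ?_, ?_⟩, fun i j hij u v => ⟨?_, ?_, ?_, ?_⟩, ?_⟩
  · rintro ⟨b, rfl⟩ ⟨b', rfl⟩
    exact h1 i b b' fun h => huv (by rw [h])
  · rintro ⟨d, rfl⟩ ⟨b, rfl⟩
    exact h2 i d b
  · rintro ⟨⟨c, x⟩, rfl⟩ ⟨⟨d, y⟩, rfl⟩ hadj
    obtain ⟨rfl, hxy⟩ := (generalizedBlowUp_adj_inl i c d x y).mp hadj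
    exact h3 i c x y hxy.symm
  · rintro ⟨⟨c, x⟩, rfl⟩ ⟨⟨d, y⟩, rfl⟩ hadj
    refine h4 i c d x y fun hcd => ?_
    subst hcd
    exact hadj ((generalizedBlowUp_adj_inl i d d x y).mpr ⟨rfl, fun hxy => huv (by rw [hxy])⟩)
  · rintro ⟨b, rfl⟩ ⟨b', rfl⟩
    exact h5 i j hij b b'
  · rintro ⟨b, rfl⟩ ⟨d, rfl⟩
    exact h6 i j hij b d
  · rintro ⟨d, rfl⟩ ⟨b, rfl⟩
    exact h7 i j hij d b
  · rintro ⟨d, rfl⟩ ⟨d', rfl⟩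
    exact h8 i j hij d d'
  · have hT : kirchhoffIndex G = (∑ i, ∑ j, ∑ u, ∑ v, R ⟨i, u⟩ ⟨j, v⟩) / 2 := by
      rw [kirchhoffIndex, Fintype.sum_sigma]
      simp only [Fintype.sum_sigma]
      congr 1
      exact Finset.sum_congr rfl fun i _ => Finset.sum_comm
    rw [hT, sum_sum_eq_sum_diag_add_two_mul (fun i j => ∑ u, ∑ v, R ⟨i, u⟩ ⟨j, v⟩), add_div,
      Finset.sum_div, mul_div_cancel_left₀ _ (two_ne_zero' ℝ)]
    · congr 1
      · exact Finset.sum_congr rfl fun i _ => sum_within_part (fun u => resistanceDist_self G _)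
          (h1 i) (h2 i) (fun b d => (hR _ _).trans (h2 i d b)) (h3 i) (h4 i)
      · refine Finset.sum_congr rfl fun i _ => ?_
        rw [Finset.mul_sum, Finset.mul_sum, ← Finset.sum_add_distrib]
        refine Finset.sum_congr rfl fun j hj => ?_
        have hij : i ≠ j := (Finset.mem_Ioi.mp hj).ne
        exact sum_between_parts (h5 i j hij) (h6 i j hij) (h7 i j hij) (h8 i j hij)
    · intro i j
      rw [Finset.sum_comm]
      exact Finset.sum_congr rfl fun v _ => Finset.sum_congr rfl fun u _ => hR _ _
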